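/- Let $\tau$ be a countable relational signature, where $R\in\tau$ has arity $a(R)$, and let $X_\tau=\prod_{R\in\tau}2^{\mathbb{N}^{a(R)}}$ be the space of $\tau$-structures with universe $\mathbb{N}$, with the product topology. Let $\mathcal{F}=\langle R_i : i\in I\rangle$ be a countable family of relations $R_i\subseteq\mathbb{N}^{b(i)}$ on $\mathbb{N}$, and let $\mathrm{Aut}(\mathcal{F})$ be the group of all permutations $g$ of $\mathbb{N}$ such that $g(R_i)=R_i$ for all $i\in I$. It acts on $X_\tau$ by taking images of relations: a tuple $x$ is in the relation $R$ of $g(M)$ if and only if $g^{-1}(x)$ is in the relation $R$ of $M$. Let $\mathscr{L}_{\omega_1\omega}(\mathcal{F})$ be the infinitary logic with equality, countable conjunctions and disjunctions and finite quantifier strings, whose atomic symbols are the relation symbols of $\tau$ together with a symbol for each $R_i$, which is always interpreted in $\mathbb{N}$ as the relation $R_i$ itself. Then every Borel set $A\subseteq X_\tau$ which is $\mathrm{Aut}(\mathcal{F})$-invariant, i.e. $g(A)=A$ for all $g\in\mathrm{Aut}(\mathcal{F})$, is definable in $\mathscr{L}_{\omega_1\omega}(\mathcal{F})$: there is a sentence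 $\varphi$ of $\mathscr{L}_{\omega_1\omega}(\mathcal{F})$ such that for all $M\in X_\tau$, $M\in A$ if and only if $M\models\varphi$. -/

import Mathlib

namespace LopezEscobar

/-- The logic space `∏_{R ∈ τ} 2^(ℕ^{a(R)})` of structures with universe `ℕ` in the relational
signature `τ` with arity function `a`. It carries the product topology (`Bool` is discrete). -/
abbrev LogicSpace {τ : Type*} (a : τ → ℕ) : Type _ :=
  ∀ R : τ, (Fin (a R) → ℕ) → Bool

/-- The logic action of `S_∞`: the relations of `act g M` are the images under `g` of the relations
of `M`. -/
def act {τ : Type*} {a : τ → ℕ} (g : Equiv.Perm ℕ) (M : LogicSpace a) : LogicSpace a :=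
  fun R x => M R (g.symm ∘ x)

/-- A set of structures is invariant under `G` if `g(A) = A` for all `g ∈ G`. -/
def IsInvariant {τ : Type*} {a : τ → ℕ} (G : Subgroup (Equiv.Perm ℕ)) (A : Set (LogicSpace a)) :
    Prop :=
  ∀ g ∈ G, act g '' A = A

/-- The group `Aut(F)` of permutations of `ℕ` which fix every relation of the family `F`. -/
def Aut {ι : Type*} {b : ι → ℕ} (F : ∀ i : ι, Set (Fin (b i) → ℕ)) :
    Subgroup (Equiv.Perm ℕ) where
  carrier := {g | ∀ (i : ι) (x : Fin (b i) → ℕ), g ∘ x ∈ F i ↔ x ∈ F i}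
  one_mem' := fun _ _ => Iff.rfl
  mul_mem' := fun {g h} hg hh i x => (hg i (h ∘ x)).trans (hh i x)
  inv_mem' := fun {g} hg i x => by
    have h := hg i (⇑g⁻¹ ∘ x)
    have e : (g : ℕ → ℕ) ∘ (⇑g⁻¹ ∘ x) = x := by
      funext k
      simp
    rw [e] at h
    exact h.symm

/-- Formulas of the infinitary logic `L_{ω₁ω}(F)` whose free variables are among `n` variables,
indexed by `Fin n`. The symbols are equality, the relation symbols of the signature (with arities
`a`), and a symbol for each member of the family `F` (with arities `b`). Conjunctions and
disjunctions are countable, and a quantifier binds the last variable. -/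
inductive Formula {τ : Type*} {ι : Type*} (a : τ → ℕ) (b : ι → ℕ) : ℕ → Type _
  | falsum {n : ℕ} : Formula a b n
  | equal {n : ℕ} (i j : Fin n) : Formula a b n
  | rel {n : ℕ} (R : τ) (v : Fin (a R) → Fin n) : Formula a b n
  | fixedRel {n : ℕ} (i : ι) (v : Fin (b i) → Fin n) : Formula a b n
  | neg {n : ℕ} (φ : Formula a b n) : Formula a b n
  | conj {n : ℕ} (φ : ℕ → Formula a b n) : Formula a b n
  | disj {n : ℕ} (φ : ℕ → Formula a b n) : Formula a b n
  | all {n : ℕ} (φ : Formula a b (n + 1)) : Formula a b n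
  | ex {n : ℕ} (φ : Formula a b (n + 1)) : Formula a b n

/-- Satisfaction in a structure `M` on `ℕ` under an assignment of the free variables. The symbols
for the family `F` always denote the given relations `F i`. -/
def Formula.Realize {τ : Type*} {ι : Type*} {a : τ → ℕ} {b : ι → ℕ}
    (F : ∀ i : ι, Set (Fin (b i) → ℕ)) (M : LogicSpace a) :
    {n : ℕ} → Formula a b n → (Fin n → ℕ) → Prop
  | _, .falsum, _ => False
  | _, .equal i j, x => x i = x j
  | _, .rel R v, x => M R (x ∘ v) = true
  | _, .fixedRel i v, x => x ∘ v ∈ F i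
  | _, .neg φ, x => ¬ φ.Realize F M x
  | _, .conj φ, x => ∀ k, (φ k).Realize F M x
  | _, .disj φ, x => ∃ k, (φ k).Realize F M x
  | _, .all φ, x => ∀ m : ℕ, φ.Realize F M (Fin.snoc x m)
  | _, .ex φ, x => ∃ m : ℕ, φ.Realize F M (Fin.snoc x m)

/-- A set of structures is definable in `L_{ω₁ω}(F)` if it is the set of models of a sentence, that
is, of a formula without free variables. -/
def IsDefinable {τ : Type*} {ι : Type*} {a : τ → ℕ} {b : ι → ℕ}
    (F : ∀ i : ι, Set (Fin (b i) → ℕ)) (A : Set (LogicSpace a)) : Prop :=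
  ∃ φ : Formula a b 0, ∀ M : LogicSpace a, M ∈ A ↔ φ.Realize F M Fin.elim0

end LopezEscobar

/-! Baire category on the Polish group $G=\mathrm{Aut}(\mathcal F)$ drives the proof. For a Borel
set $A$ let $A^{*y}(M,x)$ say that $gM\in A$ for generically many $g\in G$ with $gx=y$; the tuple
$y$ is a parameter, $x$ is the free variable. With $n=0$ and $A$ invariant this just says $M\in A$.

By induction on Borel sets, $A^{*y}$ is expressible. Countable intersections become conjunctions.
For complements, the Baire property turns "not comeager" into "comeager on some smaller basic open
set", and basic open sets are given by longer tuples $(x,s)\mapsto(y,t)$. Nonemptiness of such a set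
means that two tuples share a $G$-orbit, so orbits must be expressible too; back-and-forth shows
that orbit equivalence is agreement on all structure-independent formulas. -/

namespace LopezEscobar

open Set Filter Topology MeasureTheory

/-! ### Closure properties of expressible relations -/

section Expressible

variable {τ ι : Type*} {a : τ → ℕ} {b : ι → ℕ}

/-- A property of a structure and an assignment is expressible if it is the satisfaction relation
of a formula of `L_{ω₁ω}(F)`. -/
def Expressible (F : ∀ i : ι, Set (Fin (b i) → ℕ)) {n : ℕ}
    (P : LogicSpace a → (Fin n → ℕ) → Prop) : Prop :=
  ∃ φ : Formula a b n, ∀ M x, φ.Realize F M x ↔ P M x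

variable {F : ∀ i : ι, Set (Fin (b i) → ℕ)} {n : ℕ}

theorem Expressible.not {P : LogicSpace a → (Fin n → ℕ) → Prop} (h : Expressible F P) :
    Expressible F fun M x => ¬ P M x := by
  obtain ⟨φ, hφ⟩ := h
  exact ⟨.neg φ, fun M x => not_congr (hφ M x)⟩

theorem Expressible.forall {κ : Type*} [Countable κ] {P : κ → LogicSpace a → (Fin n → ℕ) → Prop}
    (h : ∀ k, Expressible F (P k)) : Expressible F fun M x => ∀ k, P k M x := by
  choose φ hφ using h
  cases isEmpty_or_nonempty κ
  · exact ⟨.neg .falsum, fun M x => by simp [Formula.Realize]⟩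
  · obtain ⟨e, he⟩ := exists_surjective_nat κ
    refine ⟨.conj fun k => φ (e k), fun M x => ?_⟩
    simp only [Formula.Realize, hφ]
    exact (he.forall (p := fun k => P k M x)).symm

theorem Expressible.imp {P Q : LogicSpace a → (Fin n → ℕ) → Prop} (hP : Expressible F P)
    (hQ : Expressible F Q) : Expressible F fun M x => P M x → Q M x := by
  obtain ⟨φ, hφ⟩ := hP
  obtain ⟨ψ, hψ⟩ := hQ
  refine ⟨.disj fun k => if k = 0 then .neg φ else ψ, fun M x => ?_⟩
  refine Iff.trans ?_ (imp_congr (hφ M x) (hψ M x))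
  constructor
  · rintro ⟨k, hk⟩ h
    dsimp only at hk
    split_ifs at hk
    exacts [absurd h hk, hk]
  · intro h
    by_cases hp : φ.Realize F M x
    · exact ⟨1, by simpa using h hp⟩
    · exact ⟨0, by simpa [Formula.Realize] using hp⟩

theorem Expressible.exists_snoc {P : LogicSpace a → (Fin (n + 1) → ℕ) → Prop}
    (h : Expressible F P) :
    Expressible F fun M (x : Fin n → ℕ) => ∃ m : ℕ, P M (Fin.snoc x m) := by
  obtain ⟨φ, hφ⟩ := h
  exact ⟨.ex φ, fun M x => exists_congr fun m => hφ M _⟩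

theorem Expressible.forall_append {k : ℕ} {P : LogicSpace a → (Fin (n + k) → ℕ) → Prop}
    (h : Expressible F P) :
    Expressible F fun M (x : Fin n → ℕ) => ∀ s : Fin k → ℕ, P M (Fin.append x s) := by
  induction k with
  | zero =>
    obtain ⟨φ, hφ⟩ := h
    refine ⟨φ, fun M x => ?_⟩
    rw [hφ]
    have e (s : Fin 0 → ℕ) : Fin.append x s = x := by
      funext i
      exact Fin.append_left x s i
    simp [e]
  | succ k ih =>
    obtain ⟨φ, hφ⟩ := h
    obtain ⟨ψ, hψ⟩ := ih (P := fun M x => ∀ m : ℕ, P M (Fin.snoc x m))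
      ⟨.all φ, fun M x => forall_congr' fun m => hφ M _⟩
    refine ⟨ψ, fun M x => (hψ M x).trans ?_⟩
    constructor
    · intro h s
      have := h (Fin.init s) (s (Fin.last k))
      rwa [← Fin.append_snoc, Fin.snoc_init_self] at this
    · intro h s m
      rw [← Fin.append_snoc]
      exact h _

end Expressible

/-! ### Back-and-forth: equivalent tuples are conjugate under `Aut F` -/

section BackAndForth

variable {τ ι : Type*} (a : τ → ℕ) {b : ι → ℕ} (F : ∀ i : ι, Set (Fin (b i) → ℕ))

/-- Two tuples are equivalent if they satisfy the same formulas of `L_{ω₁ω}(F)` whose satisfaction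
does not depend on the structure. -/
def TupleEquiv {n : ℕ} (x y : Fin n → ℕ) : Prop :=
  ∀ S : Set (Fin n → ℕ), Expressible F (fun (_ : LogicSpace a) z => z ∈ S) → (x ∈ S ↔ y ∈ S)

variable {a F}

theorem TupleEquiv.symm {n : ℕ} {x y : Fin n → ℕ} (h : TupleEquiv a F x y) :
    TupleEquiv a F y x := fun S hS => (h S hS).symm

-- There may be uncountably many formulas, but there are only countably many tuples: the conjunction
-- of one formula separating `y` from each inequivalent `z` suffices.
variable (a F) in
theorem expressible_tupleEquiv {n : ℕ} (y : Fin n → ℕ) :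
    Expressible F fun (_ : LogicSpace a) x => TupleEquiv a F x y := by
  have sep (z : {z : Fin n → ℕ // ¬ TupleEquiv a F z y}) : ∃ S : Set (Fin n → ℕ),
      Expressible F (fun (_ : LogicSpace a) x => x ∈ S) ∧ y ∈ S ∧ z.1 ∉ S := by
    have hz := z.2
    simp only [TupleEquiv, not_forall] at hz
    obtain ⟨S, hS, h⟩ := hz
    by_cases hy : y ∈ S
    · exact ⟨S, hS, hy, fun hz => h (by simp [hz, hy])⟩
    · exact ⟨Sᶜ, hS.not, hy, fun hz => h (by simp_all)⟩
  choose S hS hy hz using sep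
  obtain ⟨φ, hφ⟩ := Expressible.forall hS
  refine ⟨φ, fun M x => (hφ M x).trans ⟨fun h => ?_, fun h z => (h _ (hS z)).2 (hy z)⟩⟩
  by_contra hx
  exact hz ⟨x, hx⟩ (h ⟨x, hx⟩)

/-- Having an extension equivalent to `(x, c)` is itself expressible, and `x` has one, so `y` does.
-/
theorem TupleEquiv.exists_snoc {n : ℕ} {x y : Fin n → ℕ} (h : TupleEquiv a F x y) (c : ℕ) :
    ∃ d : ℕ, TupleEquiv a F (Fin.snoc x c : Fin (n + 1) → ℕ) (Fin.snoc y d) := by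
  have := (h {u | ∃ d : ℕ, TupleEquiv a F (Fin.snoc u d : Fin (n + 1) → ℕ) (Fin.snoc x c)}
    (expressible_tupleEquiv a F _).exists_snoc).1 ⟨c, fun _ _ => Iff.rfl⟩
  obtain ⟨d, hd⟩ := this
  exact ⟨d, hd.symm⟩

theorem TupleEquiv.apply_eq_iff {n : ℕ} {x y : Fin n → ℕ} (h : TupleEquiv a F x y) (i j : Fin n) :
    x i = x j ↔ y i = y j :=
  h {z | z i = z j} ⟨.equal i j, fun _ _ => Iff.rfl⟩

theorem TupleEquiv.comp_mem_iff {n : ℕ} {x y : Fin n → ℕ} (h : TupleEquiv a F x y) (i : ι)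
    (v : Fin (b i) → Fin n) : x ∘ v ∈ F i ↔ y ∘ v ∈ F i :=
  h {z | z ∘ v ∈ F i} ⟨.fixedRel i v, fun _ _ => Iff.rfl⟩

variable (a F) in
/-- A finite partial map of `ℕ`, given by a tuple of arguments and an equivalent tuple of values. -/
structure PartialAut where
  length : ℕ
  dom : Fin length → ℕ
  cod : Fin length → ℕ
  equiv : TupleEquiv a F dom cod

namespace PartialAut

/-- The graph of a partial map. -/
def graph (p : PartialAut a F) : Set (ℕ × ℕ) := range fun i => (p.dom i, p.cod i)

/-- Partial maps are preordered by inclusion of graphs. -/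
instance : Preorder (PartialAut a F) := Preorder.lift graph

theorem exists_extension_dom (p : PartialAut a F) (c : ℕ) :
    ∃ q, p ≤ q ∧ ∃ d, (c, d) ∈ q.graph := by
  obtain ⟨d, hd⟩ := p.equiv.exists_snoc c
  refine ⟨⟨_, _, _, hd⟩, ?_, d, Fin.last _, by simp⟩
  rintro _ ⟨i, rfl⟩
  exact ⟨i.castSucc, by simp⟩

theorem exists_extension_cod (p : PartialAut a F) (d : ℕ) :
    ∃ q, p ≤ q ∧ ∃ c, (c, d) ∈ q.graph := by
  obtain ⟨c, hc⟩ := p.equiv.symm.exists_snoc d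
  refine ⟨⟨_, _, _, hc.symm⟩, ?_, c, Fin.last _, by simp⟩
  rintro _ ⟨i, rfl⟩
  exact ⟨i.castSucc, by simp⟩

/-- The partial maps with a given number in the domain (`inl`) or in the range (`inr`). -/
def cofinal : ℕ ⊕ ℕ → Order.Cofinal (PartialAut a F)
  | .inl c => ⟨{p | ∃ d, (c, d) ∈ p.graph}, fun p => by
      obtain ⟨q, hpq, hq⟩ := p.exists_extension_dom c
      exact ⟨q, hq, hpq⟩⟩
  | .inr d => ⟨{p | ∃ c, (c, d) ∈ p.graph}, fun p => by
      obtain ⟨q, hpq, hq⟩ := p.exists_extension_cod d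
      exact ⟨q, hq, hpq⟩⟩

/-- The union of an ideal meeting every set in `cofinal` is the graph of a permutation. Each
condition to check involves finitely many pairs, which lie in one partial map by directedness. -/
theorem exists_perm (p : PartialAut a F) : ∃ g ∈ Aut F, ⇑g ∘ p.dom = p.cod := by
  set I := Order.idealOfCofinals p (cofinal (a := a) (F := F))
  have finite_sub {κ : Type} [Finite κ] (u : κ → ℕ × ℕ) (hu : ∀ k, ∃ q ∈ I, u k ∈ q.graph) :
      ∃ q : PartialAut a F, ∀ k, u k ∈ q.graph := by
    choose q hq hqu using hu
    have : Nonempty I := ⟨⟨p, Order.mem_idealOfCofinals p _⟩⟩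
    have hd : Directed (· ≤ ·) (Subtype.val : I → PartialAut a F) :=
      directedOn_iff_directed.1 I.directed
    obtain ⟨r, hr⟩ := hd.finite_le fun k => (⟨q k, hq k⟩ : I)
    exact ⟨r.1, fun k => hr k (hqu k)⟩
  have total (c : ℕ) : ∃ d, ∃ q ∈ I, (c, d) ∈ q.graph := by
    obtain ⟨q, ⟨d, hd⟩, hq⟩ := Order.cofinal_meets_idealOfCofinals p cofinal (.inl c)
    exact ⟨d, q, hq, hd⟩
  have onto (d : ℕ) : ∃ c, ∃ q ∈ I, (c, d) ∈ q.graph := by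
    obtain ⟨q, ⟨c, hc⟩, hq⟩ := Order.cofinal_meets_idealOfCofinals p cofinal (.inr d)
    exact ⟨c, q, hq, hc⟩
  have eq_iff {c d c' d' : ℕ} (h : ∃ q ∈ I, (c, d) ∈ q.graph) (h' : ∃ q ∈ I, (c', d') ∈ q.graph) :
      c = c' ↔ d = d' := by
    obtain ⟨q, hq⟩ := finite_sub (fun k : Bool => if k then (c, d) else (c', d'))
      (by rintro (_ | _) <;> simpa)
    obtain ⟨i, hi⟩ := hq true
    obtain ⟨j, hj⟩ := hq false
    simp only [if_true, Bool.false_eq_true, if_false, Prod.mk.injEq] at hi hj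
    rw [← hi.1, ← hi.2, ← hj.1, ← hj.2]
    exact q.equiv.apply_eq_iff i j
  choose f hf using total
  choose f' hf' using onto
  refine ⟨⟨f, f', fun c => (eq_iff (hf' _) (hf c)).2 rfl, fun d => (eq_iff (hf _) (hf' d)).1 rfl⟩,
    fun i x => ?_, funext fun i => ?_⟩
  · obtain ⟨q, hq⟩ := finite_sub (fun k => (x k, f (x k))) fun k => hf (x k)
    choose v hv using hq
    have h1 : x = q.dom ∘ v := funext fun k => (congrArg Prod.fst (hv k)).symm
    have h2 : f ∘ x = q.cod ∘ v := funext fun k => (congrArg Prod.snd (hv k)).symm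
    change f ∘ x ∈ F i ↔ x ∈ F i
    rw [h2, h1]
    exact (q.equiv.comp_mem_iff i v).symm
  · exact (eq_iff (hf _) ⟨p, Order.mem_idealOfCofinals p _, i, rfl⟩).1 rfl

end PartialAut

end BackAndForth

/-! ### Expressibility of orbits -/

section Vaught

variable {τ ι : Type*} {a : τ → ℕ} {b : ι → ℕ}

theorem realize_act_comp_iff {F : ∀ i : ι, Set (Fin (b i) → ℕ)} {g : Equiv.Perm ℕ}
    (hg : g ∈ Aut F) (M : LogicSpace a) {n : ℕ} (φ : Formula a b n) (x : Fin n → ℕ) :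
    φ.Realize F (act g M) (g ∘ x) ↔ φ.Realize F M x := by
  have snoc_eq {n : ℕ} (x : Fin n → ℕ) (m : ℕ) :
      (Fin.snoc (⇑g ∘ x) (g m) : Fin (n + 1) → ℕ) = ⇑g ∘ Fin.snoc x m :=
    (Fin.comp_snoc g x m).symm
  induction φ with
  | falsum => rfl
  | equal i j => exact g.injective.eq_iff
  | rel R v =>
    simp only [Formula.Realize, act]
    rw [← Function.comp_assoc, ← Function.comp_assoc, Equiv.symm_comp_self, Function.id_comp]
  | fixedRel i v => exact hg i (x ∘ v)
  | neg φ ih => exact not_congr (ih x)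
  | conj φ ih => exact forall_congr' fun k => ih k x
  | disj φ ih => exact exists_congr fun k => ih k x
  | all φ ih =>
    refine g.surjective.forall.trans (forall_congr' fun m => ?_)
    rw [snoc_eq]
    exact ih _
  | ex φ ih =>
    refine g.surjective.exists.trans (exists_congr fun m => ?_)
    rw [snoc_eq]
    exact ih _

variable (F : ∀ i : ι, Set (Fin (b i) → ℕ))

/-- The orbit equivalence relation of `Aut(F)` on tuples is expressible. -/
theorem expressible_orbit {n : ℕ} (y : Fin n → ℕ) :
    Expressible F fun (_ : LogicSpace a) x => ∃ g ∈ Aut F, ⇑g ∘ x = y := by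
  obtain ⟨φ, hφ⟩ := expressible_tupleEquiv a F y
  refine ⟨φ, fun M x => (hφ M x).trans ⟨fun h => (PartialAut.mk n x y h).exists_perm, ?_⟩⟩
  rintro ⟨g, hg, rfl⟩ S ⟨ψ, hψ⟩
  -- The truth of `ψ` does not depend on the structure, so replacing `M` by `act g M` is harmless.
  exact ((hψ M x).symm.trans (realize_act_comp_iff hg M ψ x).symm).trans (hψ (act g M) _)

/-! ### `Aut F` as a Polish space -/

/-- The pairs `(g, g⁻¹)` with `g ∈ Aut(F)`. -/
def autPairs : Set ((ℕ → ℕ) × (ℕ → ℕ)) :=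
  {p | (∀ m, p.2 (p.1 m) = m) ∧ (∀ m, p.1 (p.2 m) = m) ∧ ∀ i x, p.1 ∘ x ∈ F i ↔ x ∈ F i}

theorem continuous_apply_apply {X : Type*} [TopologicalSpace X] {f : X → ℕ → ℕ} {k : X → ℕ}
    (hf : Continuous f) (hk : Continuous k) : Continuous fun p => f p (k p) := by
  have : Continuous fun q : (ℕ → ℕ) × ℕ => q.1 q.2 := by
    rw [continuous_prod_of_discrete_right]
    exact fun m => continuous_apply m
  exact this.comp (hf.prodMk hk)

/-- Recording the inverse makes bijectivity a closed condition, whence Polishness and the Baire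
property of the space. -/
theorem isClosed_autPairs : IsClosed (autPairs F) := by
  have e : autPairs F = (⋂ m, {p | p.2 (p.1 m) = m}) ∩ ((⋂ m, {p | p.1 (p.2 m) = m}) ∩
      ⋂ i, ⋂ x, {p | p.1 ∘ x ∈ F i ↔ x ∈ F i}) := by
    ext p
    simp [autPairs]
  rw [e]
  refine IsClosed.inter ?_ (IsClosed.inter ?_ ?_)
  · refine isClosed_iInter fun m => isClosed_eq ?_ continuous_const
    exact continuous_apply_apply continuous_snd ((continuous_apply m).comp continuous_fst)
  · refine isClosed_iInter fun m => isClosed_eq ?_ continuous_const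
    exact continuous_apply_apply continuous_fst ((continuous_apply m).comp continuous_snd)
  · refine isClosed_iInter fun i => isClosed_iInter fun x => ?_
    have hc : Continuous fun p : (ℕ → ℕ) × (ℕ → ℕ) => p.1 ∘ x :=
      continuous_pi fun k => (continuous_apply (x k)).comp continuous_fst
    exact (isClosed_discrete {z | z ∈ F i ↔ x ∈ F i}).preimage hc

instance : PolishSpace (autPairs F) := (isClosed_autPairs F).polishSpace

instance : BaireSpace (autPairs F) :=
  inferInstance

variable {F}

/-- The permutation given by a pair `(g, g⁻¹)`. -/
def toPerm (p : autPairs F) : Equiv.Perm ℕ := ⟨p.1.1, p.1.2, p.2.1, p.2.2.1⟩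

theorem toPerm_mem (p : autPairs F) : toPerm p ∈ Aut F := p.2.2.2

theorem exists_toPerm_eq {g : Equiv.Perm ℕ} (hg : g ∈ Aut F) : ∃ p : autPairs F, toPerm p = g :=
  ⟨⟨(g, g.symm), g.symm_apply_apply, g.apply_symm_apply, hg⟩, rfl⟩

instance : Nonempty (autPairs F) := ⟨(exists_toPerm_eq (one_mem _)).choose⟩

theorem exists_comp_eq_iff {n : ℕ} {x y : Fin n → ℕ} :
    (∃ g ∈ Aut F, ⇑g ∘ x = y) ↔ ∃ p : autPairs F, toPerm p ∘ x = y := by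
  constructor
  · rintro ⟨g, hg, h⟩
    obtain ⟨p, rfl⟩ := exists_toPerm_eq hg
    exact ⟨p, h⟩
  · rintro ⟨p, h⟩
    exact ⟨_, toPerm_mem p, h⟩

theorem isOpen_comp_eq {n : ℕ} (x y : Fin n → ℕ) :
    IsOpen {p : autPairs F | toPerm p ∘ x = y} := by
  have hc : Continuous fun p : autPairs F => p.1.1 ∘ x :=
    continuous_pi fun k =>
      (continuous_apply (x k)).comp (continuous_fst.comp continuous_subtype_val)
  exact (isOpen_discrete {y}).preimage hc

theorem exists_finset_subset_of_isOpen {W : Set (autPairs F)} (hW : IsOpen W) {p : autPairs F}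
    (hp : p ∈ W) : ∃ S : Finset ℕ, ∀ q, (∀ m ∈ S, toPerm q m = toPerm p m) → q ∈ W := by
  obtain ⟨O, hO, rfl⟩ := isOpen_induced_iff.1 hW
  obtain ⟨O₁, O₂, h₁, h₂, hp₁, hp₂, hsub⟩ := isOpen_prod_iff.1 hO p.1.1 p.1.2 hp
  obtain ⟨I₁, u₁, hu₁, hI₁⟩ := isOpen_pi_iff.1 h₁ _ hp₁
  obtain ⟨I₂, u₂, hu₂, hI₂⟩ := isOpen_pi_iff.1 h₂ _ hp₂
  -- Agreement of the inverses at `m` follows from agreement of `q` and `p` at `p⁻¹ m`.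
  refine ⟨I₁ ∪ I₂.image p.1.2, fun q hq => hsub ⟨hI₁ fun m hm => ?_, hI₂ fun m hm => ?_⟩⟩
  · have := hq m (Finset.mem_union_left _ hm)
    change q.1.1 m = p.1.1 m at this
    rw [this]
    exact (hu₁ m hm).2
  · have := hq _ (Finset.mem_union_right _ (Finset.mem_image_of_mem _ hm))
    change q.1.1 (p.1.2 m) = p.1.1 (p.1.2 m) at this
    rw [p.2.2.1] at this
    have e : q.1.2 m = p.1.2 m := by
      conv_lhs => rw [← this]
      exact q.2.1 _
    rw [e]
    exact (hu₂ m hm).2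

theorem exists_tuple_subset_of_isOpen {W : Set (autPairs F)} (hW : IsOpen W) {p : autPairs F}
    (hp : p ∈ W) : ∃ (k : ℕ) (s : Fin k → ℕ), ∀ q, toPerm q ∘ s = toPerm p ∘ s → q ∈ W := by
  obtain ⟨S, hS⟩ := exists_finset_subset_of_isOpen hW hp
  refine ⟨S.card, fun i => S.equivFin.symm i, fun q hq => hS q fun m hm => ?_⟩
  simpa using congrFun hq (S.equivFin ⟨m, hm⟩)

theorem continuous_act (M : LogicSpace a) : Continuous fun p : autPairs F => act (toPerm p) M := by
  refine continuous_pi fun R => continuous_pi fun x => ?_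
  have hc : Continuous fun p : autPairs F => p.1.2 ∘ x :=
    continuous_pi fun k =>
      (continuous_apply (x k)).comp (continuous_snd.comp continuous_subtype_val)
  exact (continuous_of_discreteTopology (f := M R)).comp hc

/-! ### Vaught transforms -/

/-- The Vaught transform: `act g M ∈ A` for generically many `g ∈ Aut(F)` which map `x` to `y`. -/
def VaughtTransform (F : ∀ i : ι, Set (Fin (b i) → ℕ)) (A : Set (LogicSpace a)) {n : ℕ}
    (y : Fin n → ℕ) (M : LogicSpace a) (x : Fin n → ℕ) : Prop :=
  ∀ᶠ p : autPairs F in residual (autPairs F), toPerm p ∘ x = y → act (toPerm p) M ∈ A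

theorem VaughtTransform.exists_mem {A : Set (LogicSpace a)} {M : LogicSpace a} {n : ℕ}
    {x y : Fin n → ℕ} (h : VaughtTransform F A y M x) (p : autPairs F) (hp : toPerm p ∘ x = y) :
    ∃ q : autPairs F, toPerm q ∘ x = y ∧ act (toPerm q) M ∈ A := by
  obtain ⟨q, hq, hq'⟩ := (dense_of_mem_residual h).inter_open_nonempty _
    (isOpen_comp_eq x y) ⟨p, hp⟩
  exact ⟨q, hq, hq' hq⟩

theorem comp_append_eq_iff {n k : ℕ} (g : ℕ → ℕ) (x y : Fin n → ℕ) (s t : Fin k → ℕ) :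
    g ∘ Fin.append x s = Fin.append y t ↔ g ∘ x = y ∧ g ∘ s = t := by
  constructor
  · intro h
    exact ⟨funext fun i => by simpa using congrFun h (Fin.castAdd k i),
      funext fun i => by simpa using congrFun h (Fin.natAdd n i)⟩
  · rintro ⟨rfl, rfl⟩
    funext i
    refine Fin.addCases (fun i => ?_) (fun i => ?_) i <;> simp

theorem vaughtTransform_iInter {A : ℕ → Set (LogicSpace a)} {n : ℕ} {y x : Fin n → ℕ}
    {M : LogicSpace a} :
    VaughtTransform F (⋂ k, A k) y M x ↔ ∀ k, VaughtTransform F (A k) y M x := by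
  simp only [VaughtTransform, mem_iInter]
  rw [← eventually_countable_forall]
  exact eventually_congr (.of_forall fun p => ⟨fun h k hp => h hp k, fun h hp k => h k hp⟩)

theorem vaughtTransform_compl {A : Set (LogicSpace a)}
    (hA : MeasurableSet[borel (LogicSpace a)] A) {n : ℕ} {y x : Fin n → ℕ} {M : LogicSpace a} :
    VaughtTransform F Aᶜ y M x ↔
      ∀ t : Σ k, Fin k → ℕ, ∀ s : Fin t.1 → ℕ,
        (∃ g ∈ Aut F, ⇑g ∘ Fin.append x s = Fin.append y t.2) →
          ¬ VaughtTransform F A (Fin.append y t.2) M (Fin.append x s) := by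
  constructor
  · rintro h ⟨k, t⟩ s hg hA
    obtain ⟨p, hp⟩ := exists_comp_eq_iff.1 hg
    -- Both `A` and its complement would be generic on a nonempty open set.
    have : VaughtTransform F ∅ (Fin.append y t) M (Fin.append x s) := by
      filter_upwards [h, hA] with q hq hq' hqst
      exact hq ((comp_append_eq_iff _ _ _ _ _).1 hqst).1 (hq' hqst)
    obtain ⟨_, -, h⟩ := this.exists_mem p hp
    exact h
  · intro h
    let _ : MeasurableSpace (LogicSpace a) := borel _
    have : BorelSpace (LogicSpace a) := ⟨rfl⟩
    let _ : MeasurableSpace (autPairs F) := borel _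
    have : BorelSpace (autPairs F) := ⟨rfl⟩
    have hm : MeasurableSet {p : autPairs F | act (toPerm p) M ∈ A} :=
      (continuous_act M).measurable hA
    -- Baire property: if a generic `q` with `q x = y` lands in `A`, then `A` is generic on a basic
    -- neighbourhood of `q` inside `W`.
    obtain ⟨W, hW, hAW⟩ := hm.residualEq_isOpen
    filter_upwards [hAW] with q hq hqy hqA
    have hqW : q ∈ W := (iff_of_eq hq).1 hqA
    obtain ⟨k, s, hs⟩ := exists_tuple_subset_of_isOpen hW hqW
    have hqs := (comp_append_eq_iff (toPerm q) x y s _).2 ⟨hqy, rfl⟩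
    refine h ⟨k, toPerm q ∘ s⟩ s (exists_comp_eq_iff.2 ⟨q, hqs⟩) ?_
    filter_upwards [hAW] with r hr hrs
    exact (iff_of_eq hr).2 (hs r ((comp_append_eq_iff _ _ _ _ _).1 hrs).2)

/-- Whether `z` is in the relation `R` of `act g M` depends only on `w = g⁻¹ z`, and each possible
`w` gives a nonempty open set of `g`. -/
theorem vaughtTransform_basic {R : τ} (z : Fin (a R) → ℕ) {n : ℕ} {y x : Fin n → ℕ}
    {M : LogicSpace a} :
    VaughtTransform F {N : LogicSpace a | N R z = true} y M x ↔
      ∀ w : Fin (a R) → ℕ, (∃ g ∈ Aut F, ⇑g ∘ Fin.append x w = Fin.append y z) →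
        M R (Fin.append x w ∘ Fin.natAdd n) = true := by
  have key (w : Fin (a R) → ℕ) : Fin.append x w ∘ Fin.natAdd n = w := by
    funext i
    simp
  simp only [key]
  constructor
  · intro h w hg
    obtain ⟨p, hp⟩ := exists_comp_eq_iff.1 hg
    have h' : VaughtTransform F {N : LogicSpace a | N R z = true} (Fin.append y z) M
        (Fin.append x w) := by
      filter_upwards [h] with q hq hqw
      exact hq ((comp_append_eq_iff _ _ _ _ _).1 hqw).1
    obtain ⟨q, hq, hqA⟩ := h'.exists_mem p hp
    have : (toPerm q).symm ∘ z = w := by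
      rw [← ((comp_append_eq_iff _ _ _ _ _).1 hq).2, ← Function.comp_assoc,
        Equiv.symm_comp_self, Function.id_comp]
    simpa [act, this] using hqA
  · intro h
    refine .of_forall fun p hp => h _ (exists_comp_eq_iff.2 ⟨p, ?_⟩)
    rw [comp_append_eq_iff, ← Function.comp_assoc, Equiv.self_comp_symm, Function.id_comp]
    exact ⟨hp, rfl⟩

theorem borel_logicSpace_le [Countable τ] : borel (LogicSpace a) ≤
    MeasurableSpace.generateFrom {A | ∃ R z, A = {N : LogicSpace a | N R z = true}} := by
  rw [← BorelSpace.measurable_eq (α := LogicSpace a)]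
  refine iSup_le fun R => ?_
  refine MeasurableSpace.comap_iSup.trans_le (iSup_le fun z => ?_)
  rw [MeasurableSpace.comap_comp, ← measurable_iff_comap_le]
  refine @measurable_to_bool _ (_) _ ?_
  exact MeasurableSpace.measurableSet_generateFrom ⟨R, z, rfl⟩

theorem expressible_vaughtTransform [Countable τ] {A : Set (LogicSpace a)}
    (hA : MeasurableSet[borel (LogicSpace a)] A) :
    ∀ {n : ℕ} (y : Fin n → ℕ), Expressible F (VaughtTransform F A y) := by
  have basic_le : MeasurableSpace.generateFrom {A | ∃ R z, A = {N : LogicSpace a | N R z = true}} ≤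
      borel (LogicSpace a) := by
    refine MeasurableSpace.generateFrom_le ?_
    rintro _ ⟨R, z, rfl⟩
    have hc : Continuous fun N : LogicSpace a => N R z :=
      (continuous_apply z).comp (continuous_apply R)
    exact MeasurableSpace.measurableSet_generateFrom ((isOpen_discrete {true}).preimage hc)
  have compl {A : Set (LogicSpace a)} (hA : MeasurableSet[borel (LogicSpace a)] A)
      (ih : ∀ {n : ℕ} (y : Fin n → ℕ), Expressible F (VaughtTransform F A y)) {n : ℕ}
      (y : Fin n → ℕ) : Expressible F (VaughtTransform F Aᶜ y) := by
    have e : VaughtTransform F Aᶜ y = _ :=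
      funext fun M => funext fun x => propext (vaughtTransform_compl hA)
    rw [e]
    -- The parameters `t` form a countable conjunction; the tuple `s` becomes a finite quantifier
    -- string.
    exact .forall fun t => ((expressible_orbit F _).imp (ih _).not).forall_append
  have hA' := borel_logicSpace_le _ hA
  clear hA
  induction A, hA' using MeasurableSpace.generateFrom_induction with
  | hC A hA =>
    obtain ⟨R, z, rfl⟩ := hA
    intro n y
    have e : VaughtTransform F {N : LogicSpace a | N R z = true} y = _ :=
      funext fun M => funext fun x => propext (vaughtTransform_basic z)
    rw [e]
    exact ((expressible_orbit F _).imp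
      ⟨.rel R (Fin.natAdd n), fun _ _ => Iff.rfl⟩).forall_append
  | empty =>
    intro n y
    -- The transform of `∅` holds exactly when no `g` maps `x` to `y`.
    obtain ⟨φ, hφ⟩ := (expressible_orbit (a := a) F y).not
    refine ⟨φ, fun M x => (hφ M x).trans ?_⟩
    refine (not_congr exists_comp_eq_iff).trans ?_
    exact ⟨fun h => .of_forall fun p hp => h ⟨p, hp⟩, fun h ⟨p, hp⟩ =>
      (h.exists_mem p hp).elim fun _ h => h.2⟩
  | compl A hA ih => exact compl (basic_le _ hA) ih
  | iUnion A hA ih =>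
    have e : ⋃ k, A k = (⋂ k, (A k)ᶜ)ᶜ := by rw [← compl_iUnion, compl_compl]
    rw [e]
    intro n y
    refine compl (MeasurableSet.iInter fun k => (basic_le _ (hA k)).compl) (fun {n} y => ?_) y
    have e' : VaughtTransform F (⋂ k, (A k)ᶜ) y = _ :=
      funext fun M => funext fun x => propext vaughtTransform_iInter
    rw [e']
    exact .forall fun k => compl (basic_le _ (hA k)) (ih k) y

theorem act_mem_iff {A : Set (LogicSpace a)} (hinv : IsInvariant (Aut F) A) {g : Equiv.Perm ℕ}
    (hg : g ∈ Aut F) (M : LogicSpace a) : act g M ∈ A ↔ M ∈ A := by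
  have hinj : Function.Injective (act g : LogicSpace a → LogicSpace a) := by
    intro M N h
    funext R x
    have := congrFun (congrFun h R) (g ∘ x)
    simpa only [act, ← Function.comp_assoc, Equiv.symm_comp_self, Function.id_comp] using this
  conv_lhs => rw [← hinv g hg]
  exact hinj.mem_set_image

end Vaught

end LopezEscobar

theorem proposition6 {τ : Type*} [Countable τ] (a : τ → ℕ) {ι : Type*} [Countable ι] (b : ι → ℕ)
    (F : ∀ i : ι, Set (Fin (b i) → ℕ)) (A : Set (LopezEscobar.LogicSpace a))
    (hA : @MeasurableSet (LopezEscobar.LogicSpace a) (borel (LopezEscobar.LogicSpace a)) A)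
    (hinv : LopezEscobar.IsInvariant (LopezEscobar.Aut F) A) :
    LopezEscobar.IsDefinable F A := by
  obtain ⟨φ, hφ⟩ := LopezEscobar.expressible_vaughtTransform (F := F) hA Fin.elim0
  refine ⟨φ, fun M => Iff.trans ?_ (hφ M _).symm⟩
  constructor
  · exact fun hM => .of_forall fun p _ =>
      (LopezEscobar.act_mem_iff hinv (LopezEscobar.toPerm_mem p) M).2 hM
  · intro h
    obtain ⟨p, -, hp⟩ := h.exists_mem (Classical.arbitrary _) (Subsingleton.elim _ _)
    exact (LopezEscobar.act_mem_iff hinv (LopezEscobar.toPerm_mem p) M).1 hp
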